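/- Let $E_9$ be the elliptic curve over $\mathbb{Q}$ with Weierstrass equation $y^2 = x^3 - 2^4\cdot 3^7$, let $P_0 = (36,108)\in E_9(\mathbb{Q})$, let $K=\mathbb{Q}(\sqrt{-3})$, and fix an embedding $\overline{\mathbb{Q}}\hookrightarrow\mathbb{C}$ of an algebraic closure of $\mathbb{Q}$. Let $\zeta_9 = e^{2\pi i/9}$. 1. If $A\in E_9(\overline{\mathbb{Q}})$ satisfies $[3]A = P_0$, then $\mathbb{Q}(\zeta_9)\subset \mathbb{Q}(A, E_9[3])$, where $\mathbb{Q}(A,E_9[3])$ is the field generated over $\mathbb{Q}$ by the coordinates of $A$ and of all the points of $E_9(\overline{\mathbb{Q}})$ killed by $3$. Let moreover $p$ be an odd prime with $p\equiv 2$ or $5 \pmod 9$. Then $p$ is inert in $K$ and $E_9$ has good reduction at $p$; let $K_p$ be the completion of $K$ at the prime above $p$. 2. The point $P_0$ is not divisible by $3$ in $E_9(K_p)$: there is no $Q\in E_9(K_p)$ with $[3]Q = P_0$. 3. The reduction of $P_0$ in $E_9(\mathbb{F}_p)$ has nontrivial $3$-component (that is, in its decomposition as a sum of an element of $3$-power order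 and an element of order prime to $3$, the first summand is nonzero), and the reduction of $\left[\frac{p+1}{3}\right]P_0$ in $E_9(\mathbb{F}_p)$ is nonzero. -/

import Mathlib

open scoped WeierstrassCurve.Affine

noncomputable section

namespace CubeSum

open WeierstrassCurve.Affine

/-- The curve `E₉ : y² = x³ - 2⁴·3⁷`, as a Weierstrass equation over `ℤ`. For a field `F`, the
group `E₉(F)` is `(E9⁄F).Point`. -/
def E9 : WeierstrassCurve.Affine ℤ :=
  { a₁ := 0, a₂ := 0, a₃ := 0, a₄ := 0, a₆ := -(2 ^ 4 * 3 ^ 7) }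

theorem nonsingular_P0 : (E9⁄ℚ).Nonsingular 36 108 := by
  rw [nonsingular_iff, equation_iff]
  simp only [E9, baseChange, WeierstrassCurve.baseChange, WeierstrassCurve.map]
  norm_num

/-- The point `P₀ = (36, 108)` of `E₉(ℚ)`. -/
def P0 : (E9⁄ℚ).Point := .some 36 108 nonsingular_P0

/-- The affine coordinates of a point (no coordinates for the point at infinity). -/
def coords {F : Type*} [Field F] {W : WeierstrassCurve.Affine F} : W.Point → Set F
  | .zero => ∅
  | .some x y _ => {x, y}

open scoped Classical in
/-- The field `ℚ(A, E₉[3])`, generated over `ℚ` by the coordinates of `A` and of all the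
`3`-torsion points of `E₉` over the algebraic closure of `ℚ`. -/
def fieldOfPointAndThreeTorsion (A : (E9⁄(AlgebraicClosure ℚ)).Point) :
    IntermediateField ℚ (AlgebraicClosure ℚ) :=
  IntermediateField.adjoin ℚ
    (coords A ∪ ⋃ T ∈ {T : (E9⁄(AlgebraicClosure ℚ)).Point | (3 : ℕ) • T = 0}, coords T)

/-- The imaginary quadratic field `K = ℚ(√-3)`, inside `ℂ`. -/
abbrev K : IntermediateField ℚ ℂ :=
  IntermediateField.adjoin ℚ {((Real.sqrt 3 : ℝ) : ℂ) * Complex.I}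

instance : FiniteDimensional ℚ K := by
  refine IntermediateField.adjoin.finiteDimensional ?_
  refine ⟨Polynomial.X ^ 2 + Polynomial.C 3, by monicity!, ?_⟩
  have h : ((Real.sqrt 3 : ℝ) : ℂ) ^ 2 = 3 := by
    rw [← Complex.ofReal_pow, Real.sq_sqrt (by norm_num)]; norm_num
  simp [mul_pow, h]

instance : NumberField K where

section Reduction

variable (p : ℕ) [Fact p.Prime]

theorem equation_toZMod {W : WeierstrassCurve.Affine ℤ} {x y : ℤ_[p]}
    (h : (W⁄ℚ_[p]).Equation (x : ℚ_[p]) (y : ℚ_[p])) :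
    (W⁄(ZMod p)).Equation (PadicInt.toZMod x) (PadicInt.toZMod y) := by
  rw [equation_iff] at h ⊢
  simp only [baseChange, WeierstrassCurve.baseChange, WeierstrassCurve.map, algebraMap_int_eq, eq_intCast] at h ⊢
  have h' : y ^ 2 + W.a₁ * x * y + W.a₃ * y = x ^ 3 + W.a₂ * x ^ 2 + W.a₄ * x + W.a₆ := by
    apply PadicInt.ext
    push_cast
    exact h
  simpa using congrArg (PadicInt.toZMod (p := p)) h'

open scoped Classical in
/-- Reduction modulo a prime `p` of good reduction, `W(ℚ_p) → W(𝔽_p)`, for a Weierstrass equation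
`W` over `ℤ`: a point with coordinates in `ℤ_p` is reduced coordinatewise, and every other point
goes to the point at infinity. -/
def reduction {W : WeierstrassCurve.Affine ℤ} (hW : (W⁄(ZMod p)).Δ ≠ 0) :
    (W⁄ℚ_[p]).Point → (W⁄(ZMod p)).Point
  | .zero => 0
  | .some x y h =>
    if hxy : ‖x‖ ≤ 1 ∧ ‖y‖ ≤ 1 then
      .some (PadicInt.toZMod (⟨x, hxy.1⟩ : ℤ_[p])) (PadicInt.toZMod (⟨y, hxy.2⟩ : ℤ_[p]))
        ((equation_iff_nonsingular_of_Δ_ne_zero hW).mp (equation_toZMod p h.1))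
    else 0

variable {p}

/-- `E₉` has good reduction at every odd prime `p ≡ 2, 5 mod 9`. -/
theorem E9_disc_ne_zero (hp : p ≠ 2) (hp9 : p % 9 = 2 ∨ p % 9 = 5) : (E9⁄(ZMod p)).Δ ≠ 0 := by
  have hpp : p.Prime := Fact.out
  have hp3 : p ≠ 3 := by rintro rfl; omega
  have h2 : (2 : ZMod p) ≠ 0 := by
    intro h
    have h' : ((2 : ℕ) : ZMod p) = 0 := by exact_mod_cast h
    rw [ZMod.natCast_eq_zero_iff] at h'
    exact hp ((Nat.prime_dvd_prime_iff_eq hpp Nat.prime_two).mp h')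
  have h3 : (3 : ZMod p) ≠ 0 := by
    intro h
    have h' : ((3 : ℕ) : ZMod p) = 0 := by exact_mod_cast h
    rw [ZMod.natCast_eq_zero_iff] at h'
    exact hp3 ((Nat.prime_dvd_prime_iff_eq hpp Nat.prime_three).mp h')
  have h : (E9⁄(ZMod p)).Δ = -(2 ^ 12 * 3 ^ 17) := by
    simp only [WeierstrassCurve.Δ, WeierstrassCurve.b₂, WeierstrassCurve.b₄, WeierstrassCurve.b₆,
      WeierstrassCurve.b₈, E9, baseChange, WeierstrassCurve.baseChange, WeierstrassCurve.map,
      algebraMap_int_eq, eq_intCast]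
    push_cast
    ring
  rw [h]
  exact neg_ne_zero.mpr (mul_ne_zero (pow_ne_zero _ h2) (pow_ne_zero _ h3))

end Reduction

/-- The `ℓ`-component of the element `P` of an abelian group is nontrivial: `P = Q + R` with
`Q ≠ 0` killed by a power of `ℓ` and `R` of finite order prime to `ℓ`. -/
def HasNontrivialComponent {G : Type*} [AddCommGroup G] (ℓ : ℕ) (P : G) : Prop :=
  ∃ Q R : G, P = Q + R ∧ (∃ k : ℕ, ℓ ^ k • Q = 0) ∧ Nat.Coprime ℓ (addOrderOf R) ∧ Q ≠ 0

end CubeSum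

end

/-!
On a curve `y² = x³ + s²` the Kummer map `κ : (x, y) ↦ y - s` is a homomorphism to `Fˣ / Fˣ³`,
because three collinear points satisfy `∏ (yᵢ - s) = (ν - s)³`, where `y = ℓx + ν` is the line.
Over a field containing `s = 108√-3`, the curve `E₉` has this shape and `κ(P₀)` is the class of the
primitive cube root of unity `ω = (s - 108) / 6³`.

If `3A = P₀`, then `ω` is a cube, so the field contains a primitive ninth root of unity. In the
field generated by `A` and `E₉[3]`, which contains `s` since `(0, s)` is `3`-torsion, this is the
first claim. A finite field of order `p` or `p²` contains no such root when `p ≡ 2, 5 mod 9`, as `9`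
does not divide `p² - 1`; hence `P₀` is not divisible by `3` over `K_p`, nor modulo `p`. Finally,
points reducing to the origin have the class of a `1`-unit under `κ`, so if `nP₀` reduced to the
origin with `3 ∤ n`, then `ωⁿ` would be a cube in the residue field.
-/

namespace CubeSum

open WeierstrassCurve.Affine

section RootsOfUnity

theorem isPrimitiveRoot_three_iff {F : Type*} [Field F] (h3 : (3 : F) ≠ 0) {w : F} :
    IsPrimitiveRoot w 3 ↔ w ^ 2 + w + 1 = 0 := by
  have : NeZero ((3 : ℕ) : F) := ⟨mod_cast h3⟩
  rw [← Polynomial.isRoot_cyclotomic_iff, Polynomial.cyclotomic_three, Polynomial.IsRoot.def]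
  simp only [Polynomial.eval_add, Polynomial.eval_pow, Polynomial.eval_X, Polynomial.eval_one]

theorem isPrimitiveRoot_sq_of_isPrimitiveRoot_pow {M : Type*} [CommMonoid M] {p : ℕ}
    (hp : p.Prime) {z : M} (hz : IsPrimitiveRoot (z ^ p) p) : IsPrimitiveRoot z (p ^ 2) := by
  have : Fact p.Prime := ⟨hp⟩
  rw [← orderOf_eq_prime_pow (x := z) (n := 1) (p := p)
    (by simpa using hz.ne_one hp.one_lt) (by rw [pow_add, pow_one, pow_mul, hz.pow_eq_one])]
  exact IsPrimitiveRoot.orderOf z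

theorem dvd_card_sub_one_of_isPrimitiveRoot {k : Type*} [Field k] [Finite k] {z : k} {n : ℕ}
    [NeZero n] (hz : IsPrimitiveRoot z n) : n ∣ Nat.card k - 1 := by
  have : Fintype k := Fintype.ofFinite k
  rw [Nat.card_eq_fintype_card]
  exact hz.dvd_of_pow_eq_one _ (FiniteField.pow_card_sub_one_eq_one z (hz.ne_zero (NeZero.ne n)))

end RootsOfUnity

section Kummer

variable {F : Type*} [Field F] {W : WeierstrassCurve.Affine F} {s : F}

/-- The group `Fˣ / Fˣ³`, written additively: the target of the Kummer map. -/
abbrev CubeClassGroup (F : Type*) [Field F] : Type _ :=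
  Additive (Fˣ ⧸ (powMonoidHom 3 : Fˣ →* Fˣ).range)

/-- The class of a unit in `Fˣ / Fˣ³`. -/
def cubeClass : Additive Fˣ →+ CubeClassGroup F :=
  (QuotientGroup.mk' (powMonoidHom 3 : Fˣ →* Fˣ).range).toAdditive

theorem cubeClass_eq_cubeClass_iff {a b : Fˣ} :
    cubeClass (.ofMul a) = cubeClass (.ofMul b) ↔ ∃ u : Fˣ, (b : F) = a * u ^ 3 := by
  refine (QuotientGroup.eq (s := (powMonoidHom 3 : Fˣ →* Fˣ).range)).trans
    (exists_congr fun u => ?_)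
  rw [powMonoidHom_apply, toMul_ofMul, toMul_ofMul, eq_inv_mul_iff_mul_eq, Units.ext_iff, eq_comm,
    Units.val_mul, Units.val_pow_eq_pow_val]

theorem Y_sub_eq_slope_mul [DecidableEq F] {x₁ x₂ y₁ y₂ : F} (h₁ : W.Equation x₁ y₁)
    (h₂ : W.Equation x₂ y₂) (hxy : ¬(x₁ = x₂ ∧ y₁ = W.negY x₂ y₂)) :
    y₂ - y₁ = W.slope x₁ x₂ y₁ y₂ * (x₂ - x₁) := by
  by_cases hx : x₁ = x₂
  · subst hx
    rw [Y_eq_of_Y_ne h₁ h₂ rfl fun hy => hxy ⟨rfl, hy⟩, sub_self, sub_self, mul_zero]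
  · rw [slope_of_X_ne hx]
    have : x₁ - x₂ ≠ 0 := sub_ne_zero.mpr hx
    field_simp
    ring

/-- `W` is the curve `y² = x³ + s²`, where `2s ≠ 0`. Such curves are those with a rational
`3`-torsion point `(0, s)` on the flex tangent `y = s`. -/
structure IsMordell (W : WeierstrassCurve.Affine F) (s : F) : Prop where
  a₁ : W.a₁ = 0
  a₂ : W.a₂ = 0
  a₃ : W.a₃ = 0
  a₄ : W.a₄ = 0
  a₆ : W.a₆ = s ^ 2
  two_mul_ne_zero : 2 * s ≠ 0

namespace IsMordell

theorem equation_iff (hW : IsMordell W s) {x y : F} : W.Equation x y ↔ y ^ 2 = x ^ 3 + s ^ 2 := by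
  rw [WeierstrassCurve.Affine.equation_iff, hW.a₁, hW.a₂, hW.a₃, hW.a₄, hW.a₆]
  simp only [zero_mul, add_zero]

theorem negY_eq (hW : IsMordell W s) (x y : F) : W.negY x y = -y := by
  rw [negY, hW.a₁, hW.a₃, zero_mul, sub_zero, sub_zero]

theorem nonsingular_zero (hW : IsMordell W s) : W.Nonsingular 0 s := by
  rw [nonsingular_iff, hW.equation_iff, ← negY, hW.negY_eq]
  refine ⟨by ring, Or.inr fun h => hW.two_mul_ne_zero ?_⟩
  linear_combination h

theorem X_eq_zero_of_Y_eq (hW : IsMordell W s) {x y : F} (h : W.Equation x y) (hy : y = s) :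
    x = 0 :=
  eq_zero_of_pow_eq_zero (n := 3) (by linear_combination (y + s) * hy - hW.equation_iff.mp h)

variable [DecidableEq F]

theorem three_nsmul_some_zero (hW : IsMordell W s) (h : W.Nonsingular 0 s) :
    3 • Point.some 0 s h = 0 := by
  have hs : s ≠ W.negY 0 s := by
    rw [hW.negY_eq]
    exact fun hs => hW.two_mul_ne_zero (by linear_combination hs)
  have hslope : W.slope 0 0 s s = 0 := by
    rw [slope_of_Y_ne rfl hs, hW.a₁, hW.a₂, hW.a₄]
    simp
  have hdouble : Point.some 0 s h + Point.some 0 s h = -Point.some 0 s h := by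
    rw [Point.add_self_of_Y_ne hs, Point.neg_some, Point.some.injEq, hslope, addY, negAddY, addX,
      hW.negY_eq, hW.negY_eq, hW.a₁, hW.a₂]
    simp
  rw [succ_nsmul, two_nsmul, hdouble, neg_add_cancel]

theorem exists_line_of_add_add_eq_zero (hW : IsMordell W s) {x₁ x₂ x₃ y₁ y₂ y₃ : F}
    {h₁ : W.Nonsingular x₁ y₁} {h₂ : W.Nonsingular x₂ y₂} {h₃ : W.Nonsingular x₃ y₃}
    (h : Point.some x₁ y₁ h₁ + .some x₂ y₂ h₂ + .some x₃ y₃ h₃ = 0) :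
    ∃ ℓ ν : F, (y₁ = ℓ * x₁ + ν ∧ y₂ = ℓ * x₂ + ν ∧ y₃ = ℓ * x₃ + ν) ∧
      x₁ + x₂ + x₃ = ℓ ^ 2 ∧ x₁ * x₂ + x₂ * x₃ + x₃ * x₁ = -2 * ℓ * ν ∧
      x₁ * x₂ * x₃ = ν ^ 2 - s ^ 2 := by
  have hxy : ¬(x₁ = x₂ ∧ y₁ = W.negY x₂ y₂) := by
    rintro ⟨hx, hy⟩
    rw [Point.add_of_Y_eq hx hy, zero_add] at h
    exact Point.some_ne_zero _ h
  rw [Point.add_some hxy, add_eq_zero_iff_eq_neg, Point.neg_some, Point.some.injEq] at h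
  obtain ⟨hx₃, hy₃⟩ := h
  have hcubic := addPolynomial_slope h₁.1 h₂.1 hxy
  rw [hx₃, addPolynomial_eq, neg_inj, Cubic.prod_X_sub_C_eq, Cubic.toPoly_injective,
    Cubic.mk.injEq, hW.a₁, hW.a₂, hW.a₃, hW.a₄, hW.a₆] at hcubic
  obtain ⟨-, hsum, hsum₂, hprod⟩ := hcubic
  rw [addY, hW.negY_eq, hW.negY_eq, negAddY, hx₃] at hy₃
  refine ⟨W.slope x₁ x₂ y₁ y₂, y₁ - W.slope x₁ x₂ y₁ y₂ * x₁, ⟨by ring, ?_, ?_⟩, ?_, ?_, ?_⟩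
  · linear_combination Y_sub_eq_slope_mul h₁.1 h₂.1 hxy
  · linear_combination hy₃
  · linear_combination hsum
  · linear_combination -hsum₂
  · linear_combination hprod

end IsMordell

variable [DecidableEq F]

/-- The representative in `F` of the Kummer class of a point of `y² = x³ + s²`: the function `y - s`
has divisor `3(0, s) - 3∞`. Its value at `(0, s)` is replaced by `(2s)⁻¹`, the inverse of the value
`-2s` at `-(0, s)` up to a cube, so that the resulting map is additive modulo cubes. -/
def kummerValue (s : F) : W.Point → F
  | .zero => 1
  | .some _ y _ => if y = s then (2 * s)⁻¹ else y - s

@[simp]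
theorem kummerValue_zero : kummerValue s (0 : W.Point) = 1 := rfl

theorem kummerValue_some_of_eq {x y : F} (h : W.Nonsingular x y) (hy : y = s) :
    kummerValue s (.some x y h) = (2 * s)⁻¹ := if_pos hy

theorem kummerValue_some_of_ne {x y : F} (h : W.Nonsingular x y) (hy : y ≠ s) :
    kummerValue s (.some x y h) = y - s := if_neg hy

namespace IsMordell

theorem kummerValue_ne_zero (hW : IsMordell W s) (P : W.Point) : kummerValue s P ≠ 0 := by
  rcases P with _ | ⟨x, y, h⟩
  · exact one_ne_zero
  by_cases hy : y = s
  · exact kummerValue_some_of_eq h hy ▸ inv_ne_zero hW.two_mul_ne_zero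
  · exact kummerValue_some_of_ne h hy ▸ sub_ne_zero.mpr hy

theorem exists_kummerValue_mul_neg_eq_cube (hW : IsMordell W s) (P : W.Point) :
    ∃ u, kummerValue s P * kummerValue s (-P) = u ^ 3 := by
  have hs : -s ≠ s := fun h => hW.two_mul_ne_zero (by linear_combination -h)
  rcases P with _ | ⟨x, y, h⟩
  · exact ⟨1, by rw [← Point.zero_def, neg_zero, kummerValue_zero]; ring⟩
  have hxy := hW.equation_iff.mp h.1
  have hy_neg : W.negY x y = -y := hW.negY_eq x y
  rw [Point.neg_some]
  by_cases hy : y = s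
  · refine ⟨-1, ?_⟩
    rw [kummerValue_some_of_eq h hy, kummerValue_some_of_ne _ (by rwa [hy_neg, hy]), hy_neg, hy]
    linear_combination -inv_mul_cancel₀ hW.two_mul_ne_zero
  by_cases hy' : -y = s
  · refine ⟨-1, ?_⟩
    rw [kummerValue_some_of_ne h hy, kummerValue_some_of_eq _ (hy_neg.trans hy'),
      show y = -s by rw [← hy', neg_neg]]
    linear_combination -inv_mul_cancel₀ hW.two_mul_ne_zero
  · refine ⟨-x, ?_⟩
    rw [kummerValue_some_of_ne h hy, kummerValue_some_of_ne _ (by rwa [hy_neg]), hy_neg]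
    linear_combination -hxy

theorem exists_kummerValue_mul_mul_eq_cube_of_Y_eq (hW : IsMordell W s) {x₁ x₂ x₃ y₁ y₂ y₃ : F}
    {h₁ : W.Nonsingular x₁ y₁} {h₂ : W.Nonsingular x₂ y₂} {h₃ : W.Nonsingular x₃ y₃}
    (h : Point.some x₁ y₁ h₁ + .some x₂ y₂ h₂ + .some x₃ y₃ h₃ = 0) (hy₁ : y₁ = s) :
    ∃ u, kummerValue s (.some x₁ y₁ h₁) * kummerValue s (.some x₂ y₂ h₂) *
      kummerValue s (.some x₃ y₃ h₃) = u ^ 3 := by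
  obtain ⟨ℓ, ν, ⟨hℓ₁, hℓ₂, hℓ₃⟩, -, hsum₂, -⟩ := hW.exists_line_of_add_add_eq_zero h
  have hx₁ : x₁ = 0 := hW.X_eq_zero_of_Y_eq h₁.1 hy₁
  have hν : ν = s := by linear_combination hy₁ - hℓ₁ - ℓ * hx₁
  have hx₂₃ : x₂ * x₃ = -(2 * s) * ℓ := by
    linear_combination hsum₂ - 2 * ℓ * hν - (x₂ + x₃) * hx₁
  rw [kummerValue_some_of_eq h₁ hy₁]
  by_cases hℓ : ℓ = 0
  · refine ⟨(2 * s)⁻¹, ?_⟩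
    rw [kummerValue_some_of_eq h₂ (by linear_combination hℓ₂ + x₂ * hℓ + hν),
      kummerValue_some_of_eq h₃ (by linear_combination hℓ₃ + x₃ * hℓ + hν)]
    ring
  · have hx : x₂ * x₃ ≠ 0 := hx₂₃ ▸ mul_ne_zero (neg_ne_zero.mpr hW.two_mul_ne_zero) hℓ
    refine ⟨-ℓ, ?_⟩
    rw [kummerValue_some_of_ne h₂
        fun hy => left_ne_zero_of_mul hx (hW.X_eq_zero_of_Y_eq h₂.1 hy),
      kummerValue_some_of_ne h₃
        fun hy => right_ne_zero_of_mul hx (hW.X_eq_zero_of_Y_eq h₃.1 hy),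
      hℓ₂, hℓ₃, hν, mul_assoc, inv_mul_eq_iff_eq_mul₀ hW.two_mul_ne_zero]
    linear_combination ℓ ^ 2 * hx₂₃

theorem exists_kummerValue_mul_mul_eq_cube (hW : IsMordell W s) {P Q R : W.Point}
    (h : P + Q + R = 0) :
    ∃ u, kummerValue s P * kummerValue s Q * kummerValue s R = u ^ 3 := by
  rcases P with _ | ⟨x₁, y₁, h₁⟩
  · rw [← Point.zero_def, zero_add] at h
    rw [← Point.zero_def, kummerValue_zero, one_mul, ← neg_eq_of_add_eq_zero_right h]
    exact hW.exists_kummerValue_mul_neg_eq_cube Q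
  rcases Q with _ | ⟨x₂, y₂, h₂⟩
  · rw [← Point.zero_def, add_zero] at h
    rw [← Point.zero_def, kummerValue_zero, mul_one, ← neg_eq_of_add_eq_zero_right h]
    exact hW.exists_kummerValue_mul_neg_eq_cube _
  rcases R with _ | ⟨x₃, y₃, h₃⟩
  · rw [← Point.zero_def, add_zero] at h
    rw [← Point.zero_def, kummerValue_zero, mul_one, ← neg_eq_of_add_eq_zero_right h]
    exact hW.exists_kummerValue_mul_neg_eq_cube _
  by_cases hy₁ : y₁ = s
  · exact hW.exists_kummerValue_mul_mul_eq_cube_of_Y_eq h hy₁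
  by_cases hy₂ : y₂ = s
  · rw [add_comm (Point.some x₁ y₁ h₁)] at h
    rw [mul_comm (kummerValue s (Point.some x₁ y₁ h₁))]
    exact hW.exists_kummerValue_mul_mul_eq_cube_of_Y_eq h hy₂
  by_cases hy₃ : y₃ = s
  · rw [add_comm, ← add_assoc] at h
    rw [mul_comm, ← mul_assoc]
    exact hW.exists_kummerValue_mul_mul_eq_cube_of_Y_eq h hy₃
  obtain ⟨ℓ, ν, ⟨hℓ₁, hℓ₂, hℓ₃⟩, hsum, hsum₂, hprod⟩ := hW.exists_line_of_add_add_eq_zero h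
  -- Evaluate `x³ + s² - (ℓx + ν)² = ∏ (x - xᵢ)` at the zero of `ℓx + ν - s`, homogenized in `ℓ` so
  -- that horizontal lines are covered too.
  refine ⟨ν - s, ?_⟩
  rw [kummerValue_some_of_ne h₁ hy₁, kummerValue_some_of_ne h₂ hy₂, kummerValue_some_of_ne h₃ hy₃,
    hℓ₁, hℓ₂, hℓ₃]
  linear_combination ℓ ^ 3 * hprod + ℓ ^ 2 * (ν - s) * hsum₂ + ℓ * (ν - s) ^ 2 * hsum

theorem exists_kummerValue_add (hW : IsMordell W s) (P Q : W.Point) :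
    ∃ u : Fˣ, kummerValue s P * kummerValue s Q = kummerValue s (P + Q) * u ^ 3 := by
  obtain ⟨u, hu⟩ := hW.exists_kummerValue_mul_mul_eq_cube (add_neg_cancel (P + Q))
  obtain ⟨v, hv⟩ := hW.exists_kummerValue_mul_neg_eq_cube (P + Q)
  have h := hW.kummerValue_ne_zero (-(P + Q))
  have hu₀ : u ^ 3 ≠ 0 := hu ▸ mul_ne_zero
    (mul_ne_zero (hW.kummerValue_ne_zero P) (hW.kummerValue_ne_zero Q)) h
  have hv₀ : v ^ 3 ≠ 0 := hv ▸ mul_ne_zero (hW.kummerValue_ne_zero (P + Q)) h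
  refine ⟨Units.mk0 (u / v) (div_ne_zero (ne_zero_pow three_ne_zero hu₀)
    (ne_zero_pow three_ne_zero hv₀)), mul_right_cancel₀ h ?_⟩
  rw [hu, Units.val_mk0, mul_right_comm, hv, div_pow, mul_div_cancel₀ _ hv₀]

/-- The Kummer map `(x, y) ↦ y - s` from the points of `y² = x³ + s²` to `Fˣ / Fˣ³`, attached to the
isogeny dual to the quotient by `⟨(0, s)⟩`. -/
def kummerMap (hW : IsMordell W s) : W.Point →+ CubeClassGroup F :=
  .mk' (fun P => cubeClass (.ofMul (Units.mk0 (kummerValue s P) (hW.kummerValue_ne_zero P))))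
    fun P Q => by
      rw [← map_add, ← ofMul_mul, cubeClass_eq_cubeClass_iff]
      exact hW.exists_kummerValue_add P Q

theorem kummerMap_apply (hW : IsMordell W s) (P : W.Point) : hW.kummerMap P =
    cubeClass (.ofMul (Units.mk0 (kummerValue s P) (hW.kummerValue_ne_zero P))) := rfl

theorem exists_kummerValue_nsmul (hW : IsMordell W s) (n : ℕ) (P : W.Point) :
    ∃ u : Fˣ, kummerValue s (n • P) = kummerValue s P ^ n * u ^ 3 := by
  have h := map_nsmul hW.kummerMap n P
  rwa [kummerMap_apply, kummerMap_apply, ← map_nsmul, ← ofMul_pow, eq_comm,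
    cubeClass_eq_cubeClass_iff] at h

end IsMordell

end Kummer

section Tripling

variable {F : Type*} [Field F] {s : F}

theorem isPrimitiveRoot_three_of_sq_eq (h6 : (6 : F) ≠ 0) (hs : s ^ 2 = -34992) :
    IsPrimitiveRoot ((s - 108) / 6 ^ 3) 3 := by
  have h3 : (3 : F) ≠ 0 := fun h3 => h6 (by linear_combination 2 * h3)
  rw [isPrimitiveRoot_three_iff h3]
  field_simp
  linear_combination hs

variable [Algebra ℤ F]

theorem isMordell_E9 (h6 : (6 : F) ≠ 0) (hs : s ^ 2 = -34992) : IsMordell (E9⁄F) s where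
  a₁ := by simp [E9, baseChange, WeierstrassCurve.baseChange]
  a₂ := by simp [E9, baseChange, WeierstrassCurve.baseChange]
  a₃ := by simp [E9, baseChange, WeierstrassCurve.baseChange]
  a₄ := by simp [E9, baseChange, WeierstrassCurve.baseChange]
  a₆ := by simp [E9, baseChange, WeierstrassCurve.baseChange, hs]
  two_mul_ne_zero h0 := by
    have : (6 : F) ^ 7 = 0 := by linear_combination 8 * hs - 4 * s * h0
    exact h6 (eq_zero_of_pow_eq_zero this)

variable [DecidableEq F]

theorem kummerValue_P0 (h6 : (6 : F) ≠ 0) (hs : s ^ 2 = -34992)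
    (h : (E9⁄F).Nonsingular 36 108) :
    kummerValue s (.some 36 108 h) = (s - 108) / 6 ^ 3 * (-6) ^ 3 := by
  rw [kummerValue_some_of_ne h fun hy => (isPrimitiveRoot_three_of_sq_eq h6 hs).ne_zero
    three_ne_zero (by rw [← hy, sub_self, zero_div])]
  field_simp
  ring

theorem exists_kummerValue_nsmul_P0 (h6 : (6 : F) ≠ 0) (hs : s ^ 2 = -34992)
    (h : (E9⁄F).Nonsingular 36 108) (n : ℕ) :
    ∃ u : F, kummerValue s (n • Point.some 36 108 h) = ((s - 108) / 6 ^ 3) ^ n * u ^ 3 := by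
  obtain ⟨u, hu⟩ := (isMordell_E9 h6 hs).exists_kummerValue_nsmul n (.some 36 108 h)
  refine ⟨(-6) ^ n * u, ?_⟩
  rw [hu, kummerValue_P0 h6 hs, mul_pow, pow_right_comm, mul_assoc, mul_pow]

theorem exists_isPrimitiveRoot_nine_of_three_nsmul_eq (h6 : (6 : F) ≠ 0) (hs : s ^ 2 = -34992)
    {h : (E9⁄F).Nonsingular 36 108} {A : (E9⁄F).Point} (hA : 3 • A = .some 36 108 h) :
    ∃ z : F, IsPrimitiveRoot z 9 := by
  obtain ⟨u, hu⟩ := (isMordell_E9 h6 hs).exists_kummerValue_nsmul 3 A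
  have hcube : (kummerValue s A * u / -6) ^ 3 = (s - 108) / 6 ^ 3 := by
    rw [div_pow, div_eq_iff (pow_ne_zero 3 (neg_ne_zero.mpr h6)), ← kummerValue_P0 h6 hs h, ← hA,
      hu, mul_pow]
  exact ⟨_, isPrimitiveRoot_sq_of_isPrimitiveRoot_pow Nat.prime_three
    (hcube ▸ isPrimitiveRoot_three_of_sq_eq h6 hs)⟩

-- The scalar actions are spelled out because `IsScalarTower ℤ ℚ F` would pick the `zsmul` action.
theorem baseChange_P0 [Algebra ℚ F]
    [@IsScalarTower ℤ ℚ F Algebra.toSMul Algebra.toSMul Algebra.toSMul] :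
    ∃ h, Point.baseChange ℚ F P0 = .some 36 108 h := by
  have h : (E9⁄F).Nonsingular 36 108 := by
    have := (E9.baseChange_nonsingular (Algebra.ofId ℚ F).injective 36 108).mpr nonsingular_P0
    rwa [map_ofNat, map_ofNat] at this
  refine ⟨h, ?_⟩
  rw [P0, Point.baseChange, Point.map_some, Point.some.injEq, map_ofNat, map_ofNat]
  exact ⟨rfl, rfl⟩

end Tripling

section NinthRoots

open scoped Classical in
theorem exists_isPrimitiveRoot_nine_mem_fieldOfPointAndThreeTorsion
    {A : (E9⁄(AlgebraicClosure ℚ)).Point}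
    (hA : 3 • A = Point.baseChange ℚ (AlgebraicClosure ℚ) P0) :
    ∃ z ∈ fieldOfPointAndThreeTorsion A, IsPrimitiveRoot z 9 := by
  obtain ⟨s, hs⟩ := IsAlgClosed.exists_pow_nat_eq (-34992 : AlgebraicClosure ℚ) two_pos
  have hW := isMordell_E9 (by norm_num) hs
  obtain ⟨_, hP₀⟩ := baseChange_P0 (F := AlgebraicClosure ℚ)
  rcases A with _ | ⟨x, y, hxy⟩
  · rw [← Point.zero_def, nsmul_zero, hP₀] at hA
    exact absurd hA.symm (Point.some_ne_zero _)
  set E := fieldOfPointAndThreeTorsion (.some x y hxy)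
  have hx : x ∈ E := IntermediateField.subset_adjoin _ _ (.inl (.inl rfl))
  have hy : y ∈ E := IntermediateField.subset_adjoin _ _ (.inl (.inr rfl))
  have hsE : s ∈ E := IntermediateField.subset_adjoin _ _ <| .inr <|
    Set.mem_biUnion (hW.three_nsmul_some_zero hW.nonsingular_zero) (.inr rfl)
  have hxyE : (E9⁄E).Nonsingular ⟨x, hx⟩ ⟨y, hy⟩ :=
    (E9.baseChange_nonsingular (f := E.val) E.val.injective _ _).mp hxy
  obtain ⟨h, hP₀E⟩ := baseChange_P0 (F := E)
  have hAE : 3 • Point.some _ _ hxyE = .some 36 108 h := by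
    rw [← hP₀E]
    refine Point.map_injective (f := E.val) ?_
    rw [map_nsmul, Point.map_some]
    exact hA.trans (Point.map_baseChange E.val P0).symm
  obtain ⟨z, hz⟩ := exists_isPrimitiveRoot_nine_of_three_nsmul_eq (s := (⟨s, hsE⟩ : E))
    (by norm_num) (Subtype.ext hs) hAE
  exact ⟨z, z.2, hz.map_of_injective E.val.injective⟩

open scoped Classical in
theorem adjoin_exp_le_map_fieldOfPointAndThreeTorsion (ι : AlgebraicClosure ℚ →ₐ[ℚ] ℂ)
    (A : (E9⁄(AlgebraicClosure ℚ)).Point)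
    (hA : 3 • A = Point.baseChange ℚ (AlgebraicClosure ℚ) P0) :
    IntermediateField.adjoin ℚ {Complex.exp (2 * Real.pi * Complex.I / 9)} ≤
      (fieldOfPointAndThreeTorsion A).map ι := by
  rw [IntermediateField.adjoin_simple_le_iff]
  obtain ⟨z, hzA, hz⟩ := exists_isPrimitiveRoot_nine_mem_fieldOfPointAndThreeTorsion hA
  obtain ⟨i, -, hi⟩ := (hz.map_of_injective ι.injective).eq_pow_of_pow_eq_one
    (Complex.isPrimitiveRoot_exp 9 (by norm_num)).pow_eq_one
  exact ⟨z ^ i, pow_mem hzA i, by simpa using hi⟩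

end NinthRoots

section ResidueField

variable {L Γ₀ : Type*} [Field L] [LinearOrderedCommGroupWithZero Γ₀] (v : Valuation L Γ₀)

theorem residue_valuationSubring_eq_zero_iff (x : v.valuationSubring) :
    IsLocalRing.residue v.valuationSubring x = 0 ↔ v x < 1 := by
  rw [IsLocalRing.residue_eq_zero_iff]
  exact Valuation.mem_maximalIdeal_iff _ _

theorem residue_valuationSubring_eq_one_iff (x : v.valuationSubring) :
    IsLocalRing.residue v.valuationSubring x = 1 ↔ v (x - 1) < 1 := by
  rw [← sub_eq_zero, ← map_one (IsLocalRing.residue v.valuationSubring), ← map_sub,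
    residue_valuationSubring_eq_zero_iff]
  rfl

theorem charP_residueField_valuationSubring {p : ℕ} (hp : p.Prime) (hv : v p < 1) :
    CharP (IsLocalRing.ResidueField v.valuationSubring) p := by
  refine ringChar.of_eq (CharP.ringChar_of_prime_eq_zero hp ?_)
  rw [← map_natCast (IsLocalRing.residue v.valuationSubring), residue_valuationSubring_eq_zero_iff]
  exact_mod_cast hv

theorem valuation_natCast_eq_one_of_not_dvd {p n : ℕ} (hp : p.Prime) (hv : v p < 1)
    (hn : ¬ p ∣ n) : v n = 1 := by
  have := charP_residueField_valuationSubring v hp hv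
  refine le_antisymm (natCast_mem v.valuationSubring n) (not_lt.mp fun hlt => hn ?_)
  rw [← CharP.cast_eq_zero_iff (IsLocalRing.ResidueField v.valuationSubring),
    ← map_natCast (IsLocalRing.residue v.valuationSubring), residue_valuationSubring_eq_zero_iff]
  exact_mod_cast hlt

theorem one_lt_valuation_of_dvd_den [CharZero L] {p : ℕ} (hp : p.Prime) (hv : v p < 1) {q : ℚ}
    (hq : p ∣ q.den) : 1 < v q := by
  have hnum : v (q.num.natAbs : L) = 1 := valuation_natCast_eq_one_of_not_dvd v hp hv fun h =>
    Nat.not_coprime_of_dvd_of_dvd hp.one_lt h hq q.reduced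
  have hnum' : v (q.num : L) = 1 := by
    rcases Int.natAbs_eq q.num with h | h <;> rw [h] <;> simpa using hnum
  have hden : v (q.den : L) < 1 := by
    obtain ⟨m, hm⟩ := hq
    rw [hm, Nat.cast_mul, map_mul]
    exact mul_lt_one_of_lt_of_le hv (natCast_mem v.valuationSubring m)
  rw [Rat.cast_def, map_div₀, hnum', one_lt_div₀]
  · exact hden
  · rw [zero_lt_iff, Valuation.ne_zero_iff]
    exact mod_cast q.den_nz

theorem exists_isPrimitiveRoot_nine_residueField
    (h3 : (3 : IsLocalRing.ResidueField v.valuationSubring) ≠ 0) {w u : L}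
    (hw : IsPrimitiveRoot w 3) {n : ℕ} (hn : ¬ 3 ∣ n) (hu : v (w ^ n * u ^ 3 - 1) < 1) :
    ∃ z : IsLocalRing.ResidueField v.valuationSubring, IsPrimitiveRoot z 9 := by
  have hvw : v w = 1 := (pow_eq_one_iff_of_nonneg zero_le three_ne_zero).mp
    (by rw [← map_pow, hw.pow_eq_one, map_one])
  have hvu : v u = 1 := by
    have := v.map_one_add_of_lt hu
    rw [add_sub_cancel, map_mul, map_pow, hvw, one_pow, one_mul, map_pow] at this
    exact (pow_eq_one_iff_of_nonneg zero_le three_ne_zero).mp this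
  let w' : v.valuationSubring := ⟨w, hvw.le⟩
  let u' : v.valuationSubring := ⟨u, hvu.le⟩
  let res := IsLocalRing.residue v.valuationSubring
  have hres_w : IsPrimitiveRoot (res w') 3 := by
    have h3L : (3 : L) ≠ 0 := fun h => h3 <| by
      rw [← map_ofNat res 3, ← map_zero res]
      exact congrArg res (Subtype.ext h)
    have hw' : w' ^ 2 + w' + 1 = 0 := Subtype.ext ((isPrimitiveRoot_three_iff h3L).mp hw)
    rw [isPrimitiveRoot_three_iff h3, ← map_pow, ← map_add, ← map_one res, ← map_add, hw', map_zero]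
  have hres_u : res w' ^ n * res u' ^ 3 = 1 := by
    rw [← map_pow, ← map_pow, ← map_mul]
    exact (residue_valuationSubring_eq_one_iff v _).mpr hu
  refine ⟨(res u')⁻¹, isPrimitiveRoot_sq_of_isPrimitiveRoot_pow Nat.prime_three ?_⟩
  rw [inv_pow, ← eq_inv_of_mul_eq_one_left hres_u]
  exact hres_w.pow_of_coprime n ((Nat.prime_three.coprime_iff_not_dvd.mpr hn).symm)

end ResidueField

section KernelOfReduction

variable {L Γ₀ : Type*} [Field L] [LinearOrderedCommGroupWithZero Γ₀] (v : Valuation L Γ₀)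
  {W : WeierstrassCurve.Affine L} {s : L}

/-- `P` lies in the kernel of reduction at the valuation `v`: it is the point at infinity, or one of
its coordinates is not `v`-integral. -/
def InKernelOfReduction : W.Point → Prop
  | .zero => True
  | .some x y _ => 1 < v x ∨ 1 < v y

variable {v}

theorem IsMordell.one_lt_valuation_Y_of_one_lt_valuation_X (hW : IsMordell W s) (hs : v s ≤ 1)
    {x y : L} (h : W.Equation x y) (hx : 1 < v x) : 1 < v y := by
  contrapose! hx
  refine (pow_le_one_iff_of_nonneg zero_le three_ne_zero).mp ?_
  rw [← map_pow, eq_sub_of_add_eq (hW.equation_iff.mp h).symm]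
  refine v.map_sub_le ?_ ?_ <;> rw [map_pow]
  exacts [pow_le_one₀ zero_le hx, pow_le_one₀ zero_le hs]

/-- With `t = s / y`, the class of `(x, y)` is that of `(y - s)(x / y)³ = (1 - t)(1 - t²)`. -/
theorem IsMordell.exists_kummerValue_mul_cube_sub_one_lt [DecidableEq L] (hW : IsMordell W s)
    (hs : v s ≤ 1) {P : W.Point} (hP : InKernelOfReduction v P) :
    ∃ u, v (kummerValue s P * u ^ 3 - 1) < 1 := by
  rcases P with _ | ⟨x, y, h⟩
  · exact ⟨1, by simp [← Point.zero_def]⟩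
  have hy : 1 < v y := hP.elim (hW.one_lt_valuation_Y_of_one_lt_valuation_X hs h.1) id
  have hy₀ : y ≠ 0 := by rintro rfl; simp at hy
  have hvt : v (s / y) < 1 := by
    rw [map_div₀]
    exact (div_lt_one₀ (zero_lt_one.trans hy)).mpr (hs.trans_lt hy)
  refine ⟨x / y, ?_⟩
  have hclass : (y - s) * (x / y) ^ 3 - 1 = s / y * ((s / y) ^ 2 - s / y - 1) := by
    field_simp
    linear_combination (s - y) * hW.equation_iff.mp h.1
  rw [kummerValue_some_of_ne h (by rintro rfl; exact hs.not_gt hy), hclass, map_mul]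
  refine mul_lt_one_of_lt_of_le hvt (v.map_sub_le (v.map_sub_le ?_ hvt.le) v.map_one.le)
  rw [map_pow]
  exact pow_le_one₀ zero_le hvt.le

theorem not_inKernelOfReduction_nsmul_P0 [Algebra ℤ L] [DecidableEq L] (h6 : (6 : L) ≠ 0)
    (h3 : (3 : IsLocalRing.ResidueField v.valuationSubring) ≠ 0)
    (hk : ∀ z : IsLocalRing.ResidueField v.valuationSubring, ¬ IsPrimitiveRoot z 9)
    (hs : s ^ 2 = -34992) (h : (E9⁄L).Nonsingular 36 108) {n : ℕ} (hn : ¬ 3 ∣ n) :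
    ¬ InKernelOfReduction v (n • Point.some 36 108 h) := by
  intro hker
  have hvs : v s ≤ 1 := by
    refine (pow_le_one_iff_of_nonneg zero_le two_ne_zero).mp ?_
    rw [← map_pow, hs, Valuation.map_neg]
    exact ofNat_mem v.valuationSubring 34992
  obtain ⟨a, ha⟩ := (isMordell_E9 h6 hs).exists_kummerValue_mul_cube_sub_one_lt hvs hker
  obtain ⟨b, hb⟩ := exists_kummerValue_nsmul_P0 h6 hs h n
  rw [hb, mul_assoc, ← mul_pow] at ha
  obtain ⟨z, hz⟩ := exists_isPrimitiveRoot_nine_residueField v h3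
    (isPrimitiveRoot_three_of_sq_eq h6 hs) hn ha
  exact hk z hz

theorem three_nsmul_ne_P0 [Algebra ℤ L] [DecidableEq L] (h6 : (6 : L) ≠ 0)
    (h3 : (3 : IsLocalRing.ResidueField v.valuationSubring) ≠ 0)
    (hk : ∀ z : IsLocalRing.ResidueField v.valuationSubring, ¬ IsPrimitiveRoot z 9)
    (hs : s ^ 2 = -34992) (h : (E9⁄L).Nonsingular 36 108) (Q : (E9⁄L).Point) :
    3 • Q ≠ .some 36 108 h := by
  intro hQ
  obtain ⟨z, hz⟩ := exists_isPrimitiveRoot_nine_of_three_nsmul_eq h6 hs hQ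
  obtain ⟨z', hz'⟩ := exists_isPrimitiveRoot_nine_residueField v h3 (u := z⁻¹) (n := 1)
    (hz.pow (by norm_num) (show 9 = 3 * 3 by norm_num)) (by norm_num)
    (by rw [pow_one, inv_pow, mul_inv_cancel₀ (pow_ne_zero 3 (hz.ne_zero (by norm_num))), sub_self,
      map_zero]; exact zero_lt_one)
  exact hk z' hz'

end KernelOfReduction

section Completion

open IsDedekindDomain HeightOneSpectrum NumberField

section Dedekind

variable {R L : Type*} [CommRing R] [IsDedekindDomain R] [Field L] [Algebra R L]
  [IsFractionRing R L] (v : HeightOneSpectrum R)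

theorem residue_adicCompletionIntegers_algebraMap_surjective : Function.Surjective
    ((IsLocalRing.residue (v.adicCompletionIntegers L)).comp
      (algebraMap R (v.adicCompletionIntegers L))) := by
  intro z
  obtain ⟨z, rfl⟩ := IsLocalRing.residue_surjective z
  have hopen : IsOpen {x : v.adicCompletion L | Valued.v (x - z) < 1} := by
    have hball := Valued.isOpen_ball (v.adicCompletion L) 1
    simp only [Valuation.restrict_lt_one_iff] at hball
    exact hball.preimage (continuous_sub_right (z : v.adicCompletion L))
  obtain ⟨k, hk⟩ := (denseRange_algebraMap L v).exists_mem_open hopen ⟨z, by simp⟩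
  have hk_int : v.valuation L k ≤ 1 := by
    rw [← valuedAdicCompletion_eq_valuation']
    have := Valued.v.map_add_le hk.le ((mem_adicCompletionIntegers _ _ _).mp z.2)
    rwa [sub_add_cancel] at this
  obtain ⟨a, ha⟩ := exists_valuation_sub_lt_of_integer v hk_int 1
  rw [← valuedAdicCompletion_eq_valuation'] at ha
  refine ⟨a, ?_⟩
  rw [← sub_eq_zero, RingHom.comp_apply, ← map_sub]
  refine (residue_valuationSubring_eq_zero_iff Valued.v _).mpr ?_
  have hsplit : ((algebraMap R (v.adicCompletionIntegers L) a - z : v.adicCompletionIntegers L) :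
      v.adicCompletion L) = algebraMap L (v.adicCompletion L) (algebraMap R L a - k) +
        (algebraMap L (v.adicCompletion L) k - z) := by
    rw [map_sub, sub_add_sub_cancel]
    rfl
  rw [hsplit]
  exact Valued.v.map_add_lt ha hk

theorem ker_residue_adicCompletionIntegers_algebraMap :
    RingHom.ker ((IsLocalRing.residue (v.adicCompletionIntegers L)).comp
      (algebraMap R (v.adicCompletionIntegers L))) = v.asIdeal := by
  ext a
  rw [← valuation_lt_one_iff_mem (K := L), ← valuedAdicCompletion_eq_valuation']
  exact residue_valuationSubring_eq_zero_iff Valued.v _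

theorem natCard_residueField_adicCompletionIntegers :
    Nat.card (IsLocalRing.ResidueField (v.adicCompletionIntegers L)) =
      Nat.card (R ⧸ v.asIdeal) := by
  rw [← ker_residue_adicCompletionIntegers_algebraMap (L := L)]
  exact Nat.card_congr (RingHom.quotientKerEquivOfSurjective
    (residue_adicCompletionIntegers_algebraMap_surjective v)).symm.toEquiv

theorem valued_natCast_lt_one {p : ℕ} (hv : (p : R) ∈ v.asIdeal) :
    Valued.v (p : v.adicCompletion L) < 1 := by
  have h : Valued.v (algebraMap L (v.adicCompletion L) (algebraMap R L p)) < 1 :=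
    (valuedAdicCompletion_eq_valuation' v _).trans_lt ((valuation_lt_one_iff_mem v _).mpr hv)
  simpa only [map_natCast] using h

end Dedekind

section NumberField

variable {L : Type*} [Field L] [NumberField L] {p : ℕ}

theorem exists_heightOneSpectrum_natCast_mem (hp : p.Prime) :
    ∃ v : HeightOneSpectrum (𝓞 L), (p : 𝓞 L) ∈ v.asIdeal := by
  have hp_unit : ¬ IsUnit (p : 𝓞 L) := by
    rw [← Ideal.span_singleton_eq_top, ← Ideal.absNorm_eq_one_iff, Ideal.absNorm_span_natCast,
      RingOfIntegers.rank]
    exact (Nat.one_lt_pow Module.finrank_pos.ne' hp.one_lt).ne'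
  obtain ⟨M, hM, hpM⟩ := exists_max_ideal_of_mem_nonunits hp_unit
  refine ⟨⟨M, hM.isPrime, ?_⟩, hpM⟩
  rintro rfl
  exact hp.ne_zero (Nat.cast_eq_zero.mp hpM)

theorem natCard_residueField_dvd_pow_finrank (v : HeightOneSpectrum (𝓞 L))
    (hv : (p : 𝓞 L) ∈ v.asIdeal) :
    Nat.card (IsLocalRing.ResidueField (v.adicCompletionIntegers L)) ∣ p ^ Module.finrank ℚ L := by
  rw [natCard_residueField_adicCompletionIntegers, ← RingOfIntegers.rank,
    ← Ideal.absNorm_span_natCast]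
  exact Ideal.absNorm_dvd_absNorm_of_le ((Ideal.span_singleton_le_iff_mem _).mpr hv)

end NumberField

theorem sqrt_three_mul_I_sq : (((Real.sqrt 3 : ℝ) : ℂ) * Complex.I) ^ 2 = -3 := by
  rw [mul_pow, ← Complex.ofReal_pow, Real.sq_sqrt (by norm_num), Complex.I_sq]
  norm_num

theorem finrank_K_le : Module.finrank ℚ K ≤ 2 := by
  have hmonic : (Polynomial.X ^ 2 + Polynomial.C 3 : Polynomial ℚ).Monic := by monicity!
  have hroot : Polynomial.aeval (((Real.sqrt 3 : ℝ) : ℂ) * Complex.I)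
      (Polynomial.X ^ 2 + Polynomial.C 3 : Polynomial ℚ) = 0 := by simp [sqrt_three_mul_I_sq]
  rw [IntermediateField.adjoin.finrank ⟨_, hmonic, hroot⟩]
  refine (Polynomial.natDegree_le_natDegree (minpoly.min ℚ _ hmonic hroot)).trans ?_
  compute_degree

theorem exists_sq_eq_ringOfIntegers_K : ∃ s : 𝓞 K, s ^ 2 = -34992 := by
  let t : K := 108 * ⟨_, IntermediateField.mem_adjoin_simple_self ℚ _⟩
  have ht : t ^ 2 = -34992 := by
    rw [mul_pow, show (⟨_, _⟩ : K) ^ 2 = -3 from Subtype.ext sqrt_three_mul_I_sq]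
    norm_num
  refine ⟨⟨t, .of_pow two_pos ?_⟩, RingOfIntegers.ext ht⟩
  rw [ht]
  exact_mod_cast isIntegral_algebraMap (R := ℤ) (A := K) (x := -34992)

theorem not_isPrimitiveRoot_nine {k : Type*} [Field k] {p : ℕ} (hp : p.Prime)
    (hp9 : p % 9 = 2 ∨ p % 9 = 5) (hk : Nat.card k ∣ p ^ 2) (z : k) : ¬ IsPrimitiveRoot z 9 := by
  intro hz
  have : Finite k :=
    Nat.finite_of_card_ne_zero (ne_zero_of_dvd_ne_zero (pow_ne_zero 2 hp.ne_zero) hk)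
  have hcard : 1 < Nat.card k := Finite.one_lt_card
  have hcard_mod : Nat.card k % 9 = 1 := by
    have := dvd_card_sub_one_of_isPrimitiveRoot hz
    omega
  have hsq_mod : p ^ 2 % 9 = 4 ∨ p ^ 2 % 9 = 7 := by
    rcases hp9 with h | h <;> simp [Nat.pow_mod, h]
  obtain ⟨i, hi, hki⟩ := (Nat.dvd_prime_pow hp).mp hk
  interval_cases i
  · exact hcard.ne' (hki.trans (pow_zero p))
  · rw [pow_one] at hki
    omega
  · rw [hki] at hcard_mod
    omega

variable {p : ℕ} {v : HeightOneSpectrum (𝓞 K)}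

theorem not_isPrimitiveRoot_nine_residueField (hp : p.Prime) (hp9 : p % 9 = 2 ∨ p % 9 = 5)
    (hv : (p : 𝓞 K) ∈ v.asIdeal) (z : IsLocalRing.ResidueField (v.adicCompletionIntegers K)) :
    ¬ IsPrimitiveRoot z 9 :=
  not_isPrimitiveRoot_nine hp hp9
    ((natCard_residueField_dvd_pow_finrank v hv).trans (pow_dvd_pow p finrank_K_le)) z

theorem six_ne_zero_residueField (hp : p.Prime) (hp2 : p ≠ 2) (hp9 : p % 9 = 2 ∨ p % 9 = 5)
    (hv : (p : 𝓞 K) ∈ v.asIdeal) :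
    (6 : IsLocalRing.ResidueField (v.adicCompletionIntegers K)) ≠ 0 := by
  have : CharP (IsLocalRing.ResidueField (v.adicCompletionIntegers K)) p :=
    charP_residueField_valuationSubring Valued.v hp (valued_natCast_lt_one v hv)
  intro h6
  have hdvd : p ∣ 6 := (CharP.cast_eq_zero_iff _ p 6).mp (mod_cast h6)
  rcases hp.dvd_mul.mp (show p ∣ 2 * 3 from hdvd) with h | h
  · exact hp2 ((Nat.prime_dvd_prime_iff_eq hp Nat.prime_two).mp h)
  · rw [(Nat.prime_dvd_prime_iff_eq hp Nat.prime_three).mp h] at hp9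
    omega

theorem three_ne_zero_residueField (hp : p.Prime) (hp2 : p ≠ 2) (hp9 : p % 9 = 2 ∨ p % 9 = 5)
    (hv : (p : 𝓞 K) ∈ v.asIdeal) :
    (3 : IsLocalRing.ResidueField (v.adicCompletionIntegers K)) ≠ 0 :=
  fun h3 => six_ne_zero_residueField hp hp2 hp9 hv (by linear_combination 2 * h3)

theorem exists_sq_eq_of_ringOfIntegers_K_ringHom {F : Type*} [Ring F] (f : 𝓞 K →+* F) :
    ∃ s : F, s ^ 2 = -34992 := by
  obtain ⟨s, hs⟩ := exists_sq_eq_ringOfIntegers_K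
  exact ⟨f s, by rw [← map_pow, hs, map_neg, map_ofNat]⟩

open scoped Classical in
theorem three_nsmul_ne_baseChange_P0_adicCompletion (hp : p.Prime) (hp2 : p ≠ 2)
    (hp9 : p % 9 = 2 ∨ p % 9 = 5) (hv : (p : 𝓞 K) ∈ v.asIdeal)
    (Q : (E9⁄(v.adicCompletion K)).Point) :
    3 • Q ≠ Point.baseChange ℚ (v.adicCompletion K) P0 := by
  obtain ⟨s, hs⟩ := exists_sq_eq_of_ringOfIntegers_K_ringHom
    (algebraMap (𝓞 K) (v.adicCompletion K))
  obtain ⟨h, hP₀⟩ := baseChange_P0 (F := v.adicCompletion K)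
  rw [hP₀]
  have : CharZero (v.adicCompletion K) := algebraRat.charZero _
  exact three_nsmul_ne_P0 (v := Valued.v) (by norm_num)
    (three_ne_zero_residueField hp hp2 hp9 hv)
    (not_isPrimitiveRoot_nine_residueField hp hp9 hv) hs h Q

end Completion

section Reduction

open IsDedekindDomain NumberField

theorem hasNontrivialComponent_of_forall_nsmul_ne {G : Type*} [AddCommGroup G] {ℓ : ℕ}
    (hℓ : ℓ.Prime) {P : G} (hfin : IsOfFinAddOrder P) (hP : ∀ A : G, ℓ • A ≠ P) :
    HasNontrivialComponent ℓ P := by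
  obtain ⟨k, m, hm, hord⟩ := Nat.exists_eq_pow_mul_and_not_dvd hfin.addOrderOf_pos.ne' ℓ hℓ.ne_one
  have hcop : ℓ.Coprime m := hℓ.coprime_iff_not_dvd.mpr hm
  have hzero : ((ℓ ^ k * m : ℕ) : ℤ) • P = 0 := by
    rw [← hord, natCast_zsmul, addOrderOf_nsmul_eq_zero]
  obtain ⟨a, b, hab⟩ := Nat.isCoprime_iff_coprime.mpr (hcop.pow_left (k + 1))
  have hP_eq : P = (b * m) • P + (a * (ℓ ^ (k + 1) : ℕ)) • P := by
    rw [← add_smul, add_comm, hab, one_smul]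
  refine ⟨_, _, hP_eq, ⟨k, ?_⟩, hcop.coprime_dvd_right (addOrderOf_dvd_of_nsmul_eq_zero ?_), ?_⟩
  · rw [← natCast_zsmul, ← mul_smul, show ((ℓ ^ k : ℕ) : ℤ) * (b * m) = b * (ℓ ^ k * m : ℕ) by
      push_cast; ring, mul_smul, hzero, smul_zero]
  · rw [← natCast_zsmul, ← mul_smul, show (m : ℤ) * (a * (ℓ ^ (k + 1) : ℕ)) =
      a * ℓ * (ℓ ^ k * m : ℕ) by push_cast; ring, mul_smul, hzero, smul_zero]
  · intro hQ
    rw [hQ, zero_add] at hP_eq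
    refine hP ((a * (ℓ ^ k : ℕ)) • P) ?_
    rw [← natCast_zsmul, ← mul_smul, show (ℓ : ℤ) * (a * (ℓ ^ k : ℕ)) = a * (ℓ ^ (k + 1) : ℕ) by
      push_cast; ring, ← hP_eq]

instance finite_point {F : Type*} [Field F] [Finite F] (W : WeierstrassCurve.Affine F) :
    Finite W.Point :=
  Finite.of_injective (β := Option {xy : F × F // W.Nonsingular xy.1 xy.2})
    W.nonsingularPointEquiv W.nonsingularPointEquiv.injective

variable {p : ℕ} [Fact p.Prime]

theorem reduction_P0 [DecidableEq ℚ_[p]] (hW : (E9⁄(ZMod p)).Δ ≠ 0) :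
    ∃ h, reduction p hW (Point.baseChange ℚ ℚ_[p] P0) = .some 36 108 h := by
  obtain ⟨h, hP₀⟩ := baseChange_P0 (F := ℚ_[p])
  have h36 : ‖(36 : ℚ_[p])‖ ≤ 1 := by simpa using Padic.norm_int_le_one (p := p) 36
  have h108 : ‖(108 : ℚ_[p])‖ ≤ 1 := by simpa using Padic.norm_int_le_one (p := p) 108
  have e36 : PadicInt.toZMod (⟨36, h36⟩ : ℤ_[p]) = 36 := map_ofNat PadicInt.toZMod 36
  have e108 : PadicInt.toZMod (⟨108, h108⟩ : ℤ_[p]) = 108 := map_ofNat PadicInt.toZMod 108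
  have h' := (equation_iff_nonsingular_of_Δ_ne_zero hW).mp
    (equation_toZMod p (x := ⟨36, h36⟩) (y := ⟨108, h108⟩) h.1)
  rw [e36, e108] at h'
  refine ⟨h', ?_⟩
  rw [hP₀, reduction, dif_pos ⟨h36, h108⟩, Point.some.injEq]
  exact ⟨e36, e108⟩

theorem three_nsmul_ne_P0_of_ringHom {F k : Type*} [Field F] [DecidableEq F] [Field k]
    (f : F →+* k) (h6 : (6 : k) ≠ 0) (hk : ∀ z : k, ¬ IsPrimitiveRoot z 9) {s : k}
    (hs : s ^ 2 = -34992) {h : (E9⁄F).Nonsingular 36 108} (A : (E9⁄F).Point) :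
    3 • A ≠ .some 36 108 h := by
  classical
  intro hA
  have h' : (E9⁄k).Nonsingular 36 108 := by
    have := (E9.baseChange_nonsingular (f := f.toIntAlgHom) f.injective 36 108).mpr h
    rwa [map_ofNat, map_ofNat] at this
  have hmap : 3 • Point.map f.toIntAlgHom A = .some 36 108 h' := by
    rw [← map_nsmul, hA, Point.map_some, Point.some.injEq]
    exact ⟨map_ofNat f 36, map_ofNat f 108⟩
  obtain ⟨z, hz⟩ := exists_isPrimitiveRoot_nine_of_three_nsmul_eq h6 hs hmap
  exact hk z hz

theorem hasNontrivialComponent_reduction_P0 [DecidableEq ℚ_[p]] [DecidableEq (ZMod p)]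
    (hp2 : p ≠ 2) (hp9 : p % 9 = 2 ∨ p % 9 = 5) :
    HasNontrivialComponent 3
      (reduction p (E9_disc_ne_zero hp2 hp9) (Point.baseChange ℚ ℚ_[p] P0)) := by
  have hp : p.Prime := Fact.out
  obtain ⟨v, hv⟩ := exists_heightOneSpectrum_natCast_mem (L := K) hp
  have : CharP (IsLocalRing.ResidueField (v.adicCompletionIntegers K)) p :=
    charP_residueField_valuationSubring Valued.v hp (valued_natCast_lt_one v hv)
  obtain ⟨s, hs⟩ := exists_sq_eq_of_ringOfIntegers_K_ringHom
    ((IsLocalRing.residue (v.adicCompletionIntegers K)).comp (algebraMap (𝓞 K) _))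
  obtain ⟨h, hred⟩ := reduction_P0 (E9_disc_ne_zero hp2 hp9)
  rw [hred]
  exact hasNontrivialComponent_of_forall_nsmul_ne Nat.prime_three (isOfFinAddOrder_of_finite _) <|
    three_nsmul_ne_P0_of_ringHom (ZMod.castHom dvd_rfl _)
      (six_ne_zero_residueField hp hp2 hp9 hv)
      (not_isPrimitiveRoot_nine_residueField hp hp9 hv) hs

theorem inKernelOfReduction_baseChange {W : WeierstrassCurve.Affine ℤ}
    {hW : (W⁄(ZMod p)).Δ ≠ 0} {L Γ₀ : Type*} [Field L] [LinearOrderedCommGroupWithZero Γ₀]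
    [DecidableEq ℚ_[p]] [DecidableEq L] [Algebra ℤ L] [Algebra ℚ L]
    [@IsScalarTower ℤ ℚ L Algebra.toSMul Algebra.toSMul Algebra.toSMul]
    {v : Valuation L Γ₀} (hv : v p < 1)
    {P : (W⁄ℚ).Point} (hP : reduction p hW (Point.baseChange ℚ ℚ_[p] P) = 0) :
    InKernelOfReduction v (Point.baseChange ℚ L P) := by
  have hp : p.Prime := Fact.out
  have : CharZero L := algebraRat.charZero _
  rcases P with _ | ⟨x, y, h⟩
  · rw [← Point.zero_def, map_zero]
    trivial
  have hxy : ¬ (‖(x : ℚ_[p])‖ ≤ 1 ∧ ‖(y : ℚ_[p])‖ ≤ 1) := by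
    intro hxy
    exact Point.some_ne_zero _ ((dif_pos hxy).symm.trans hP)
  have hden {q : ℚ} (hq : ¬ ‖(q : ℚ_[p])‖ ≤ 1) : 1 < v (Algebra.ofId ℚ L q) := by
    rw [eq_ratCast]
    exact one_lt_valuation_of_dvd_den v hp hv (not_not.mp fun h => hq (Padic.norm_rat_le_one h))
  exact (not_and_or.mp hxy).imp hden hden

theorem reduction_nsmul_P0_ne_zero [DecidableEq ℚ_[p]] (hp2 : p ≠ 2)
    (hp9 : p % 9 = 2 ∨ p % 9 = 5) {n : ℕ} (hn : ¬ 3 ∣ n) :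
    reduction p (E9_disc_ne_zero hp2 hp9) (Point.baseChange ℚ ℚ_[p] (n • P0)) ≠ 0 := by
  classical
  intro hred
  have hp : p.Prime := Fact.out
  obtain ⟨v, hv⟩ := exists_heightOneSpectrum_natCast_mem (L := K) hp
  obtain ⟨s, hs⟩ := exists_sq_eq_of_ringOfIntegers_K_ringHom
    (algebraMap (𝓞 K) (v.adicCompletion K))
  obtain ⟨h, hP₀⟩ := baseChange_P0 (F := v.adicCompletion K)
  have hker := inKernelOfReduction_baseChange (valued_natCast_lt_one (L := K) v hv) hred
  rw [map_nsmul, hP₀] at hker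
  have : CharZero (v.adicCompletion K) := algebraRat.charZero _
  exact not_inKernelOfReduction_nsmul_P0 (by norm_num) (three_ne_zero_residueField hp hp2 hp9 hv)
    (not_isPrimitiveRoot_nine_residueField hp hp9 hv) hs h hn hker

end Reduction

end CubeSum

open CubeSum WeierstrassCurve.Affine IsDedekindDomain NumberField in
open scoped Classical in
theorem mainTheorem6 :
    (∀ (ι : AlgebraicClosure ℚ →ₐ[ℚ] ℂ) (A : (E9⁄(AlgebraicClosure ℚ)).Point),
      (3 : ℕ) • A = Point.baseChange ℚ (AlgebraicClosure ℚ) P0 →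
      IntermediateField.adjoin ℚ {Complex.exp (2 * Real.pi * Complex.I / 9)} ≤
        (fieldOfPointAndThreeTorsion A).map ι) ∧
    ∀ (p : ℕ) [Fact p.Prime] (hp : p ≠ 2) (hp9 : p % 9 = 2 ∨ p % 9 = 5),
      (∀ v : HeightOneSpectrum (𝓞 K), (p : 𝓞 K) ∈ v.asIdeal →
        ¬ ∃ Q : (E9⁄(v.adicCompletion K)).Point,
          (3 : ℕ) • Q = Point.baseChange ℚ (v.adicCompletion K) P0) ∧
      HasNontrivialComponent 3
        (reduction p (E9_disc_ne_zero hp hp9) (Point.baseChange ℚ ℚ_[p] P0)) ∧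
      reduction p (E9_disc_ne_zero hp hp9)
        (Point.baseChange ℚ ℚ_[p] (((p + 1) / 3) • P0)) ≠ 0 := by
  refine ⟨adjoin_exp_le_map_fieldOfPointAndThreeTorsion, fun p hp hp2 hp9 => ⟨fun v hv => ?_,
    hasNontrivialComponent_reduction_P0 hp2 hp9, ?_⟩⟩
  · rintro ⟨Q, hQ⟩
    exact three_nsmul_ne_baseChange_P0_adicCompletion hp.out hp2 hp9 hv Q hQ
  · exact reduction_nsmul_P0_ne_zero hp2 hp9 (by omega)
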